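/- Let $n,t$ be natural numbers and let $\mathbb R[\bar X]=\mathbb R[X_1,\dots,X_n]$. For $p\in\mathbb R[\bar X]^{t\times t}$ let $p^*$ denote the transpose of $p$, and let $\operatorname{Sym}\mathbb R[\bar X]^{t\times t}=\{p\in\mathbb R[\bar X]^{t\times t}\mid p^*=p\}$. For a (possibly infinite) set $G\subseteq\operatorname{Sym}\mathbb R[\bar X]^{t\times t}$ put $$S_G=\{x\in\mathbb R^n\mid g(x)\text{ is positive semidefinite for all }g\in G\}$$ and let $$M_G=\Big\{\sum_{i=1}^N p_i^*g_ip_i\;\Big|\;N\in\mathbb N,\ g_i\in\{1\}\cup G,\ p_i\in\mathbb R[\bar X]^{t\times t}\Big\}$$ be the quadratic module generated by $G$, where $1$ is the identity matrix. Suppose that $M_G$ is archimedean, i.e. for every $a\in\mathbb R[\bar X]^{t\times t}$ there is a positive integer $N$ with $N\cdot 1-a^*a\in M_G$. Let $f\in\operatorname{Sym}\mathbb R[\bar X]^{t\times t}$ be such that $f(x)$ is positive definite for all $x\in S_G$. Then $f\in M_G$. -/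

import Mathlib

namespace MatrixPositivstellensatz

/-- The ring `ℝ[X₁, …, Xₙ]^{t × t}` of real `t × t` matrix polynomials in `n` variables.
The involution of `ℝ[X₁, …, Xₙ]` is trivial, so the involution of this ring is the transpose. -/
abbrev MatPoly (n t : ℕ) : Type :=
  Matrix (Fin t) (Fin t) (MvPolynomial (Fin n) ℝ)

/-- The value `p(x)` of a matrix polynomial `p` at a point `x ∈ ℝⁿ`, taken entrywise. -/
noncomputable def evalAt {n t : ℕ} (x : Fin n → ℝ) (p : MatPoly n t) :
    Matrix (Fin t) (Fin t) ℝ :=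
  p.map (MvPolynomial.eval x)

/-- `S_G`: the set of all `x ∈ ℝⁿ` such that `g(x)` is positive semidefinite for all `g ∈ G`. -/
def positivitySet {n t : ℕ} (G : Set (MatPoly n t)) : Set (Fin n → ℝ) :=
  {x | ∀ g ∈ G, (evalAt x g).PosSemidef}

/-- `M_G`: the quadratic module generated by `G`, i.e. the set of all finite sums
`∑ pᵢ* gᵢ pᵢ` with `gᵢ ∈ {1} ∪ G` and arbitrary matrix polynomials `pᵢ`. -/
def quadraticModule {n t : ℕ} (G : Set (MatPoly n t)) : Set (MatPoly n t) :=
  {q | ∃ (N : ℕ) (g p : Fin N → MatPoly n t),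
    (∀ i, g i ∈ ({1} ∪ G : Set (MatPoly n t))) ∧ q = ∑ i, (p i).transpose * g i * p i}

/-- A quadratic module `M` of matrix polynomials is archimedean if for every matrix polynomial
`a` there is a positive integer `N` with `N - a* a ∈ M`. -/
def IsArchimedean {n t : ℕ} (M : Set (MatPoly n t)) : Prop :=
  ∀ a : MatPoly n t, ∃ N : ℕ, 0 < N ∧ (N : MatPoly n t) - a.transpose * a ∈ M

end MatrixPositivstellensatz

/-! ### The scalar archimedean Positivstellensatz. -/

namespace MatrixPositivstellensatz

/-! The polynomials `m` with `m • 1 ∈ M_G` form an archimedean quadratic module `scalarPart G` of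
the polynomial ring, whose nonnegativity set `K` is compact and lies in `S_G`. By compactness `ε ≤ f
≤ b` on `K` as quadratic forms on unit vectors. Choose a polynomial `q` with `q(y)²` close to `y -
ε` on `[ε, b]` and write `f = ε + q(f)² + u(f)`. As `f` is symmetric, `q(f)²` is a hermitian square,
and `u(f)` has small entries on `K`. The scalar Positivstellensatz `mem_of_pos` puts `c ± u(f)ᵢⱼ`
into `scalarPart G`, and `smul_one_add_mem` turns these entrywise bounds into membership of `u(f)`
plus a constant that `ε` pays for.

For `mem_of_pos`: if `Q - pΣ` is proper, a maximal proper quadratic module above it yields a real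
point where `Q ≥ 0` and `p ≤ 0`. Otherwise `s * p - 1 ∈ Q` for a sum of squares `s`, and a descent
on constants gives `p ∈ Q`. -/

/-- Quadratic modules of a commutative ring. -/
structure IsQuadraticModule {A : Type*} [CommRing A] (Q : Set A) : Prop where
  one_mem : 1 ∈ Q
  add_mem : ∀ {a b : A}, a ∈ Q → b ∈ Q → a + b ∈ Q
  sq_mul_mem : ∀ (a : A) {b : A}, b ∈ Q → a ^ 2 * b ∈ Q

/-- A set of elements of a real algebra is bounding if every element is bounded above,
modulo the set, by a real constant. -/
def IsBounding {A : Type*} [CommRing A] [Algebra ℝ A] (Q : Set A) : Prop :=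
  ∀ a : A, ∃ r : ℝ, algebraMap ℝ A r - a ∈ Q

namespace IsQuadraticModule

section Ring

variable {A : Type*} [CommRing A] {Q : Set A}

theorem zero_mem (hQ : IsQuadraticModule Q) : 0 ∈ Q := by
  simpa using hQ.sq_mul_mem 0 hQ.one_mem

theorem sq_mem (hQ : IsQuadraticModule Q) (a : A) : a ^ 2 ∈ Q := by
  simpa using hQ.sq_mul_mem a hQ.one_mem

theorem isSumSq_mul_mem (hQ : IsQuadraticModule Q) {s b : A} (hs : IsSumSq s) (hb : b ∈ Q) :
    s * b ∈ Q := by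
  induction hs with
  | zero => simpa using hQ.zero_mem
  | sq_add a _ ih =>
    rw [add_mul, ← sq]
    exact hQ.add_mem (hQ.sq_mul_mem a hb) ih

theorem isSumSq_mem (hQ : IsQuadraticModule Q) {s : A} (hs : IsSumSq s) : s ∈ Q := by
  simpa using hQ.isSumSq_mul_mem hs hQ.one_mem

/-- Adjoining an element to a quadratic module. -/
theorem adjoin (hQ : IsQuadraticModule Q) (a : A) :
    IsQuadraticModule {x | ∃ q ∈ Q, ∃ s, IsSumSq s ∧ x = q + a * s} where
  one_mem := ⟨1, hQ.one_mem, 0, .zero, by simp⟩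
  add_mem := by
    rintro _ _ ⟨q, hq, s, hs, rfl⟩ ⟨q', hq', s', hs', rfl⟩
    exact ⟨q + q', hQ.add_mem hq hq', s + s', hs.add hs', by ring⟩
  sq_mul_mem := by
    rintro b _ ⟨q, hq, s, hs, rfl⟩
    exact ⟨b ^ 2 * q, hQ.sq_mul_mem b hq, b * b * s, (IsSumSq.mul_self b).mul hs, by ring⟩

/-- Every proper quadratic module is contained in a maximal proper one. -/
theorem exists_maximal (hQ : IsQuadraticModule Q) (h1 : -1 ∉ Q) :
    ∃ P, Q ⊆ P ∧ Maximal (fun P : Set A => IsQuadraticModule P ∧ -1 ∉ P) P := by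
  refine zorn_subset_nonempty {P : Set A | IsQuadraticModule P ∧ -1 ∉ P} ?_ Q ⟨hQ, h1⟩
  rintro c hc hchain ⟨P₀, hP₀⟩
  refine ⟨⋃₀ c, ⟨⟨⟨P₀, hP₀, (hc hP₀).1.one_mem⟩, ?_, ?_⟩, ?_⟩, fun P hP => Set.subset_sUnion_of_mem hP⟩
  · rintro a b ⟨P, hP, ha⟩ ⟨P', hP', hb⟩
    rcases hchain.total hP hP' with h | h
    · exact ⟨P', hP', (hc hP').1.add_mem (h ha) hb⟩
    · exact ⟨P, hP, (hc hP).1.add_mem ha (h hb)⟩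
  · rintro a b ⟨P, hP, hb⟩
    exact ⟨P, hP, (hc hP).1.sq_mul_mem a hb⟩
  · rintro ⟨P, hP, h⟩
    exact (hc hP).2 h

end Ring

section Algebra

variable {A : Type*} [CommRing A] [Algebra ℝ A] {Q : Set A}

theorem algebraMap_mul_mem (hQ : IsQuadraticModule Q) {r : ℝ} (hr : 0 ≤ r) {b : A} (hb : b ∈ Q) :
    algebraMap ℝ A r * b ∈ Q := by
  have := hQ.sq_mul_mem (algebraMap ℝ A (√r)) hb
  rwa [← map_pow, Real.sq_sqrt hr] at this

theorem algebraMap_mem (hQ : IsQuadraticModule Q) {r : ℝ} (hr : 0 ≤ r) : algebraMap ℝ A r ∈ Q := by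
  simpa using hQ.algebraMap_mul_mem hr hQ.one_mem

theorem mem_of_algebraMap_mul_mem (hQ : IsQuadraticModule Q) {r : ℝ} (hr : 0 < r) {b : A}
    (hb : algebraMap ℝ A r * b ∈ Q) : b ∈ Q := by
  have := hQ.algebraMap_mul_mem (inv_nonneg.2 hr.le) hb
  rwa [← mul_assoc, ← map_mul, inv_mul_cancel₀ hr.ne', map_one, one_mul] at this

theorem algebraMap_notMem (hQ : IsQuadraticModule Q) (h1 : -1 ∉ Q) {r : ℝ} (hr : r < 0) :
    algebraMap ℝ A r ∉ Q := fun h =>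
  h1 <| hQ.mem_of_algebraMap_mul_mem (r := -r) (by linarith) (by simpa using h)

/-- Elements of `Q ∩ -Q` may be multiplied by arbitrary elements. -/
theorem mul_mem_of_mem_of_neg_mem (hQ : IsQuadraticModule Q) {x : A} (hx : x ∈ Q) (hx' : -x ∈ Q)
    (b : A) : b * x ∈ Q := by
  -- `4bx = (b + 1)² x + (b - 1)² (-x)`.
  refine hQ.mem_of_algebraMap_mul_mem (r := 4) (by norm_num) ?_
  convert hQ.add_mem (hQ.sq_mul_mem (b + 1) hx) (hQ.sq_mul_mem (b - 1) hx') using 1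
  simp only [map_ofNat]
  ring

/-- If both fail, adjoining `a` or `-a` produces `-1`. Combining the two identities so that `a`
cancels gives `-s ∈ Q`, hence `a * s ∈ Q` and `-1 ∈ Q`. -/
theorem mem_or_neg_mem_of_maximal
    (hQ : Maximal (fun P : Set A => IsQuadraticModule P ∧ -1 ∉ P) Q) (a : A) : a ∈ Q ∨ -a ∈ Q := by
  have hM := hQ.prop.1
  have key : ∀ b : A, b ∉ Q → ∃ q ∈ Q, ∃ s, IsSumSq s ∧ -1 = q + b * s := by
    intro b hb
    by_contra hcon
    refine hb (hQ.le_of_ge ⟨hM.adjoin b, hcon⟩ (fun q hq => ⟨q, hq, 0, .zero, by simp⟩)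
      ⟨0, hM.zero_mem, 1, by simp, by simp⟩)
  by_contra! h
  obtain ⟨q, hq, s, hs, e⟩ := key a h.1
  obtain ⟨q', hq', s', hs', e'⟩ := key (-a) h.2
  have hneg : -s ∈ Q := by
    have : -s = (s' * q + s * q') + s' := by linear_combination s' * e + s * e'
    rw [this]
    exact hM.add_mem (hM.add_mem (hM.isSumSq_mul_mem hs' hq) (hM.isSumSq_mul_mem hs hq'))
      (hM.isSumSq_mem hs')
  apply hQ.prop.2
  rw [e]
  exact hM.add_mem hq (hM.mul_mem_of_mem_of_neg_mem (hM.isSumSq_mem hs) hneg a)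

/-- Elements that are infinitesimal with respect to `Q`. -/
def infinitesimals (Q : Set A) : Set A :=
  {a | ∀ ε : ℝ, 0 < ε → algebraMap ℝ A ε + a ∈ Q ∧ algebraMap ℝ A ε - a ∈ Q}

theorem zero_mem_infinitesimals (hQ : IsQuadraticModule Q) : 0 ∈ infinitesimals Q := fun ε hε => by
  simpa using hQ.algebraMap_mem (A := A) hε.le

theorem add_mem_infinitesimals (hQ : IsQuadraticModule Q) {a b : A} (ha : a ∈ infinitesimals Q)
    (hb : b ∈ infinitesimals Q) : a + b ∈ infinitesimals Q := fun ε hε => by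
  have e : algebraMap ℝ A ε = algebraMap ℝ A (ε / 2) + algebraMap ℝ A (ε / 2) := by
    rw [← map_add, add_halves]
  obtain ⟨h₁, h₂⟩ := ha (ε / 2) (half_pos hε)
  obtain ⟨h₃, h₄⟩ := hb (ε / 2) (half_pos hε)
  rw [e]
  constructor
  · convert hQ.add_mem h₁ h₃ using 1; ring
  · convert hQ.add_mem h₂ h₄ using 1; ring

theorem sub_sq_mem_of_mem_infinitesimals (hQ : IsQuadraticModule Q) {a : A}
    (ha : a ∈ infinitesimals Q) {ε : ℝ} (hε : 0 < ε) : algebraMap ℝ A (ε ^ 2) - a ^ 2 ∈ Q := by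
  obtain ⟨h₁, h₂⟩ := ha ε hε
  -- `2ε(ε² - a²) = (ε - a)²(ε + a) + (ε + a)²(ε - a)`.
  refine hQ.mem_of_algebraMap_mul_mem (r := 2 * ε) (by linarith) ?_
  convert hQ.add_mem (hQ.sq_mul_mem (algebraMap ℝ A ε - a) h₁)
    (hQ.sq_mul_mem (algebraMap ℝ A ε + a) h₂) using 1
  simp only [map_mul, map_ofNat, map_pow]
  ring

/-- With `μ² - b² ∈ Q` and `ε = δμ`, use `2δμ(δμ ± ab) = μ²(δ² - a²) + δ²(μ² - b²) + (μa ± δb)²`. -/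
theorem mul_mem_infinitesimals (hQ : IsQuadraticModule Q) (hb : IsBounding Q) {a : A}
    (ha : a ∈ infinitesimals Q) (b : A) : a * b ∈ infinitesimals Q := fun ε hε => by
  obtain ⟨N₀, hN₀⟩ := hb (b ^ 2)
  obtain ⟨N, hN, hNpos⟩ : ∃ N : ℝ, algebraMap ℝ A N - b ^ 2 ∈ Q ∧ 0 < N := by
    refine ⟨|N₀| + 1, ?_, by positivity⟩
    convert hQ.add_mem hN₀ (hQ.algebraMap_mem (r := |N₀| + 1 - N₀)
      (by linarith [le_abs_self N₀])) using 1
    simp only [map_sub, map_add]; ring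
  obtain ⟨μ, hμ, rfl⟩ : ∃ μ : ℝ, 0 < μ ∧ N = μ ^ 2 :=
    ⟨√N, Real.sqrt_pos.2 hNpos, (Real.sq_sqrt hNpos.le).symm⟩
  obtain ⟨δ, hδ, rfl⟩ : ∃ δ : ℝ, 0 < δ ∧ ε = δ * μ :=
    ⟨ε / μ, by positivity, (div_mul_cancel₀ _ hμ.ne').symm⟩
  have hsum := hQ.add_mem
    (hQ.algebraMap_mul_mem hNpos.le (hQ.sub_sq_mem_of_mem_infinitesimals ha hδ))
    (hQ.algebraMap_mul_mem (sq_nonneg δ) hN)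
  constructor
  · refine hQ.mem_of_algebraMap_mul_mem (r := 2 * (δ * μ)) (by positivity) ?_
    convert hQ.add_mem hsum (hQ.sq_mem (algebraMap ℝ A μ * a + algebraMap ℝ A δ * b)) using 1
    simp only [map_mul, map_ofNat, map_pow]
    ring
  · refine hQ.mem_of_algebraMap_mul_mem (r := 2 * (δ * μ)) (by positivity) ?_
    convert hQ.add_mem hsum (hQ.sq_mem (algebraMap ℝ A μ * a - algebraMap ℝ A δ * b)) using 1
    simp only [map_mul, map_ofNat, map_pow]
    ring

/-- A Dedekind cut: `r` is the infimum of the constants bounding `a` from above modulo `Q`.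
Maximality turns failure of an upper bound just below `r` into a lower bound. -/
theorem exists_sub_algebraMap_mem_infinitesimals
    (hQ : Maximal (fun P : Set A => IsQuadraticModule P ∧ -1 ∉ P) Q) (hb : IsBounding Q) (a : A) :
    ∃ r : ℝ, a - algebraMap ℝ A r ∈ infinitesimals Q := by
  have hM := hQ.prop.1
  have hup : ∀ {r s : ℝ}, r ≤ s → algebraMap ℝ A r - a ∈ Q → algebraMap ℝ A s - a ∈ Q := by
    intro r s hrs h
    convert hM.add_mem h (hM.algebraMap_mem (sub_nonneg.2 hrs)) using 1
    rw [map_sub]; ring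
  set S : Set ℝ := {r | algebraMap ℝ A r - a ∈ Q} with hS
  have hne : S.Nonempty := hb a
  have hbdd : BddBelow S := by
    obtain ⟨r, hr⟩ := hb (-a)
    refine ⟨-r, fun s hs => ?_⟩
    by_contra! hlt
    refine hM.algebraMap_notMem hQ.prop.2 (r := r + s) (by linarith) ?_
    convert hM.add_mem hr hs using 1
    rw [map_add]; ring
  refine ⟨sInf S, fun ε hε => ⟨?_, ?_⟩⟩
  · have : sInf S - ε ∉ S := fun h => by linarith [csInf_le hbdd h]
    convert (mem_or_neg_mem_of_maximal hQ _).resolve_left this using 1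
    rw [map_sub]; ring
  · obtain ⟨s, hs, hlt⟩ := (csInf_lt_iff hbdd hne).1 (lt_add_of_pos_right (sInf S) hε)
    convert hup hlt.le hs using 1
    rw [map_add]; ring

/-- If `s * p - 1` lies in an archimedean quadratic module for some sum of squares `s`, then so
does `p`. -/
theorem mem_of_isSumSq_mul_sub_one_mem (hQ : IsQuadraticModule Q) (hb : IsBounding Q) {p s : A}
    (hs : IsSumSq s) (h : s * p - 1 ∈ Q) : p ∈ Q := by
  have hmono : ∀ {a : A} {r r' : ℝ}, r ≤ r' → algebraMap ℝ A r + a ∈ Q →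
      algebraMap ℝ A r' + a ∈ Q := by
    intro a r r' hr ha
    convert hQ.add_mem ha (hQ.algebraMap_mem (sub_nonneg.2 hr)) using 1
    rw [map_sub]; ring
  obtain ⟨k₁, hk₁⟩ := hb s
  obtain ⟨k₂, hk₂⟩ := hb (s ^ 2 * p + 1)
  obtain ⟨k, hk, hks, hkp⟩ : ∃ k : ℝ, 0 < k ∧ algebraMap ℝ A (2 * k) - s ∈ Q ∧
      algebraMap ℝ A (2 * k) - (s ^ 2 * p + 1) ∈ Q := by
    refine ⟨|k₁| + |k₂| + 1, by positivity, ?_, ?_⟩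
    · rw [sub_eq_add_neg] at hk₁ ⊢
      exact hmono (by linarith [le_abs_self k₁, abs_nonneg k₁, abs_nonneg k₂]) hk₁
    · rw [sub_eq_add_neg] at hk₂ ⊢
      exact hmono (by linarith [le_abs_self k₂, abs_nonneg k₁, abs_nonneg k₂]) hk₂
  -- The descent rests on `k²(r + p) - 1 = (k - s)²(r + p) + 2k(sp - 1) + rs(2k - s) + (2k - (s²p +
  -- 1))`. The decrement `1/k²` does not depend on `r`, so finitely many steps make the constant
  -- nonpositive.
  have hstep : ∀ r : ℝ, 0 ≤ r → algebraMap ℝ A r + p ∈ Q →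
      algebraMap ℝ A (r - (k ^ 2)⁻¹) + p ∈ Q := by
    intro r hr hrp
    refine hQ.mem_of_algebraMap_mul_mem (r := k ^ 2) (by positivity) ?_
    have e : algebraMap ℝ A (k ^ 2) * algebraMap ℝ A (k ^ 2)⁻¹ = 1 := by
      rw [← map_mul, mul_inv_cancel₀ (by positivity), map_one]
    have h₁ := hQ.sq_mul_mem (algebraMap ℝ A k - s) hrp
    have h₂ := hQ.algebraMap_mul_mem (r := 2 * k) (by positivity) h
    have h₃ := hQ.algebraMap_mul_mem hr (hQ.isSumSq_mul_mem hs hks)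
    convert hQ.add_mem (hQ.add_mem (hQ.add_mem h₁ h₂) h₃) hkp using 1
    rw [map_sub, mul_add, mul_sub, e]
    simp only [map_mul, map_ofNat, map_pow]
    ring
  obtain ⟨r₀, hr₀⟩ := hb (-p)
  rw [sub_neg_eq_add] at hr₀
  by_contra hp
  have hpos : ∀ r : ℝ, algebraMap ℝ A r + p ∈ Q → 0 < r := by
    intro r hr
    by_contra! hle
    exact hp (by simpa using hmono hle hr)
  have hall : ∀ m : ℕ, algebraMap ℝ A (r₀ - m * (k ^ 2)⁻¹) + p ∈ Q := by
    intro m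
    induction m with
    | zero => simpa using hr₀
    | succ m ih =>
      convert hstep _ (hpos _ ih).le ih using 3
      push_cast; ring
  obtain ⟨m, hm⟩ := exists_nat_gt (r₀ * k ^ 2)
  have := hpos _ (hall m)
  have hk2 : 0 < k ^ 2 := by positivity
  rw [← div_eq_mul_inv, sub_pos, div_lt_iff₀ hk2] at this
  linarith

end Algebra

/-- A maximal proper archimedean quadratic module of a polynomial ring is contained in the set of
polynomials that are nonnegative at some point. -/
theorem exists_point_of_maximal {σ : Type*} {Q : Set (MvPolynomial σ ℝ)}
    (hQ : Maximal (fun P : Set (MvPolynomial σ ℝ) => IsQuadraticModule P ∧ -1 ∉ P) Q)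
    (hb : IsBounding Q) : ∃ x : σ → ℝ, ∀ q ∈ Q, 0 ≤ MvPolynomial.eval x q := by
  have hM := hQ.prop.1
  -- The point collects the real parts of the variables; every polynomial then differs from its
  -- value there by an infinitesimal.
  choose x hx using fun i => exists_sub_algebraMap_mem_infinitesimals hQ hb (MvPolynomial.X i)
  have key : ∀ p : MvPolynomial σ ℝ,
      p - algebraMap ℝ _ (MvPolynomial.eval x p) ∈ infinitesimals Q := by
    intro p
    induction p using MvPolynomial.induction_on with
    | C a => simpa [MvPolynomial.algebraMap_eq] using hM.zero_mem_infinitesimals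
    | add p q hp hq =>
      convert hM.add_mem_infinitesimals hp hq using 1
      rw [map_add, map_add]; ring
    | mul_X p i hp =>
      convert hM.add_mem_infinitesimals (hM.mul_mem_infinitesimals hb (hx i) p)
        (hM.mul_mem_infinitesimals hb hp (algebraMap ℝ _ (x i))) using 1
      rw [map_mul, MvPolynomial.eval_X, map_mul]; ring
  refine ⟨x, fun q hq => ?_⟩
  by_contra! hlt
  set c := MvPolynomial.eval x q
  refine hM.algebraMap_notMem hQ.prop.2 (r := c / 2) (by linarith) ?_
  convert hM.add_mem (key q (-(c / 2)) (by linarith)).2 hq using 1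
  have : algebraMap ℝ (MvPolynomial σ ℝ) c = algebraMap ℝ _ (c / 2) + algebraMap ℝ _ (c / 2) := by
    rw [← map_add, add_halves]
  rw [map_neg]
  linear_combination -this

/-- The scalar archimedean Positivstellensatz. -/
theorem mem_of_pos {σ : Type*} {Q : Set (MvPolynomial σ ℝ)} (hQ : IsQuadraticModule Q)
    (hb : IsBounding Q) {p : MvPolynomial σ ℝ}
    (hp : ∀ x : σ → ℝ, (∀ q ∈ Q, 0 ≤ MvPolynomial.eval x q) → 0 < MvPolynomial.eval x p) :
    p ∈ Q := by
  have hsub : Q ⊆ {x | ∃ q ∈ Q, ∃ s, IsSumSq s ∧ x = q + -p * s} :=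
    fun q hq => ⟨q, hq, 0, .zero, by simp⟩
  by_cases h : (-1 : MvPolynomial σ ℝ) ∈ {x | ∃ q ∈ Q, ∃ s, IsSumSq s ∧ x = q + -p * s}
  · obtain ⟨q, hq, s, hs, e⟩ := h
    refine hQ.mem_of_isSumSq_mul_sub_one_mem hb hs ?_
    rwa [show s * p - 1 = q by linear_combination e]
  · obtain ⟨P, hP, hmax⟩ := (hQ.adjoin (-p)).exists_maximal h
    obtain ⟨x, hx⟩ := exists_point_of_maximal hmax
      fun a => (hb a).imp fun r hr => hP (hsub hr)
    have h₁ := hp x fun q hq => hx q (hP (hsub hq))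
    have h₂ := hx (-p) (hP ⟨0, hQ.zero_mem, 1, by simp, by simp⟩)
    rw [map_neg] at h₂
    linarith

end IsQuadraticModule
end MatrixPositivstellensatz

/-! ### Spectral bounds, approximation and compactness over the reals. -/

namespace MatrixPositivstellensatz

section RealMatrix

open scoped MatrixOrder

variable {ι : Type*} [Fintype ι] [DecidableEq ι]

/-- Polynomial functional calculus preserves positivity for real symmetric matrices. -/
theorem posSemidef_aeval {A : Matrix ι ι ℝ} (hA : A.IsSymm) {a b : ℝ}
    (ha : ∀ v : ι → ℝ, a * (v ⬝ᵥ v) ≤ v ⬝ᵥ A.mulVec v)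
    (hb : ∀ v : ι → ℝ, v ⬝ᵥ A.mulVec v ≤ b * (v ⬝ᵥ v)) {u : Polynomial ℝ}
    (hu : ∀ y ∈ Set.Icc a b, 0 ≤ u.eval y) : (Polynomial.aeval A u).PosSemidef := by
  have hs : IsSelfAdjoint A := by
    rw [IsSelfAdjoint, Matrix.star_eq_conjTranspose, Matrix.conjTranspose_eq_transpose_of_trivial]
    exact hA
  have hr : ∀ r : ℝ, IsSelfAdjoint (algebraMap ℝ (Matrix ι ι ℝ) r) :=
    fun r => (IsSelfAdjoint.all r).algebraMap _
  have h₁ : algebraMap ℝ _ a ≤ A := by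
    refine Matrix.le_iff.2 (.of_dotProduct_mulVec_nonneg (hs.sub (hr a)) fun v => ?_)
    simpa [Matrix.sub_mulVec, Algebra.algebraMap_eq_smul_one, Matrix.smul_mulVec] using ha v
  have h₂ : A ≤ algebraMap ℝ _ b := by
    refine Matrix.le_iff.2 (.of_dotProduct_mulVec_nonneg ((hr b).sub hs) fun v => ?_)
    simpa [Matrix.sub_mulVec, Algebra.algebraMap_eq_smul_one, Matrix.smul_mulVec] using hb v
  rw [algebraMap_le_iff_le_spectrum] at h₁
  rw [le_algebraMap_iff_spectrum_le] at h₂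
  rw [← Matrix.nonneg_iff_posSemidef, ← cfc_polynomial u A]
  exact cfc_nonneg fun y hy => hu y ⟨h₁ y hy, h₂ y hy⟩

theorem abs_apply_le_of_posSemidef {B : Matrix ι ι ℝ} {δ : ℝ}
    (h₁ : (algebraMap ℝ (Matrix ι ι ℝ) δ + B).PosSemidef)
    (h₂ : (algebraMap ℝ (Matrix ι ι ℝ) δ - B).PosSemidef) (i j : ι) : |B i j| ≤ δ := by
  have hB : B j i = B i j := by
    have := h₁.1.apply i j
    simp only [Matrix.add_apply, Matrix.algebraMap_matrix_apply, star_trivial,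
      eq_comm (a := j) (b := i)] at this
    linarith
  -- Test on `eᵢ + s eⱼ`. Adding the cases `δ + B` and `δ - B` with opposite signs `s = ±1` cancels
  -- the diagonal of `B`.
  have key : ∀ C : Matrix ι ι ℝ, ∀ s : ℝ, C.PosSemidef →
      0 ≤ C i i + s * C i j + s * C j i + s ^ 2 * C j j := by
    intro C s hC
    have := hC.dotProduct_mulVec_nonneg (Pi.single i 1 + s • Pi.single j 1)
    simp only [star_trivial, Matrix.mulVec_add, Matrix.mulVec_smul, Matrix.mulVec_single_one,
      add_dotProduct, smul_dotProduct, single_one_dotProduct, Pi.add_apply, Pi.smul_apply,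
      Matrix.col_apply, smul_eq_mul] at this
    linarith
  have a₁ := key _ 1 h₁
  have a₂ := key _ (-1) h₁
  have a₃ := key _ 1 h₂
  have a₄ := key _ (-1) h₂
  simp only [Matrix.add_apply, Matrix.sub_apply, Matrix.algebraMap_matrix_apply, hB, if_true,
    Algebra.algebraMap_self, RingHom.id_apply, eq_comm (a := j) (b := i)] at a₁ a₂ a₃ a₄
  rw [abs_le]
  constructor <;> linarith

theorem abs_aeval_apply_le {A : Matrix ι ι ℝ} (hA : A.IsSymm) {a b : ℝ}
    (ha : ∀ v : ι → ℝ, a * (v ⬝ᵥ v) ≤ v ⬝ᵥ A.mulVec v)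
    (hb : ∀ v : ι → ℝ, v ⬝ᵥ A.mulVec v ≤ b * (v ⬝ᵥ v)) {u : Polynomial ℝ} {δ : ℝ}
    (hu : ∀ y ∈ Set.Icc a b, |u.eval y| ≤ δ) (i j : ι) : |Polynomial.aeval A u i j| ≤ δ := by
  refine abs_apply_le_of_posSemidef ?_ ?_ i j
  · rw [← Polynomial.aeval_C (x := A), ← map_add]
    refine posSemidef_aeval hA ha hb fun y hy => ?_
    rw [Polynomial.eval_add, Polynomial.eval_C]
    linarith [neg_le_of_abs_le (hu y hy)]
  · rw [← Polynomial.aeval_C (x := A), ← map_sub]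
    refine posSemidef_aeval hA ha hb fun y hy => ?_
    rw [Polynomial.eval_sub, Polynomial.eval_C]
    linarith [le_of_abs_le (hu y hy)]

end RealMatrix

theorem exists_polynomial_sq_near_sub (ε b : ℝ) {δ : ℝ} (hδ : 0 < δ) :
    ∃ q : Polynomial ℝ, ∀ y ∈ Set.Icc ε b, |y - ε - q.eval y ^ 2| ≤ δ := by
  -- `m` bounds `|q + √(y - ε)|` once `q` is within `1` of the root.
  set m : ℝ := 2 * √(b - ε) + 1 with hm
  have hmpos : 0 < m := by positivity
  obtain ⟨q, hq⟩ := exists_polynomial_near_of_continuousOn ε b (fun y => √(y - ε))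
    (by fun_prop) (min 1 (δ / m)) (by positivity)
  refine ⟨q, fun y hy => ?_⟩
  obtain ⟨h₁, h₂⟩ := lt_min_iff.1 (hq y hy)
  have hs : √(y - ε) ≤ √(b - ε) := Real.sqrt_le_sqrt (by linarith [hy.2])
  have e : y - ε - q.eval y ^ 2 =
      -((q.eval y - √(y - ε)) * ((q.eval y - √(y - ε)) + 2 * √(y - ε))) := by
    nth_rw 1 [← Real.sq_sqrt (sub_nonneg.2 hy.1)]
    ring
  rw [e, abs_neg, abs_mul]
  have h₃ : |(q.eval y - √(y - ε)) + 2 * √(y - ε)| ≤ m := by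
    refine (abs_add_le _ _).trans ?_
    rw [abs_of_nonneg (by positivity : 0 ≤ 2 * √(y - ε))]
    linarith
  calc _ ≤ δ / m * m := by gcongr
    _ = δ := div_mul_cancel₀ _ hmpos.ne'

theorem isCompact_setOf_dotProduct_self_eq_one (ι : Type*) [Fintype ι] :
    IsCompact {v : ι → ℝ | v ⬝ᵥ v = 1} := by
  refine (isCompact_univ_pi fun _ : ι => isCompact_Icc (a := (-1 : ℝ)) (b := 1)).of_isClosed_subset
    (isClosed_eq (by fun_prop) continuous_const) fun v hv i _ => ?_
  rw [Set.mem_Icc, ← abs_le, ← sq_le_one_iff_abs_le_one, ← (show v ⬝ᵥ v = 1 from hv), sq]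
  exact Finset.single_le_sum (f := fun i => v i * v i) (fun i _ => mul_self_nonneg _)
    (Finset.mem_univ i)

/-- A bound for a quadratic form on unit vectors extends to all vectors. -/
theorem mul_dotProduct_le_of_unit {ι : Type*} [Fintype ι] {A : Matrix ι ι ℝ} {a : ℝ}
    (h : ∀ v : ι → ℝ, v ⬝ᵥ v = 1 → a ≤ v ⬝ᵥ A.mulVec v) (v : ι → ℝ) :
    a * (v ⬝ᵥ v) ≤ v ⬝ᵥ A.mulVec v := by
  rcases eq_or_ne v 0 with rfl | hv
  · simp
  have hpos : 0 < v ⬝ᵥ v := lt_of_le_of_ne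
    (Finset.sum_nonneg fun i _ => mul_self_nonneg _) (Ne.symm (by simpa using hv))
  have hs : (√(v ⬝ᵥ v))⁻¹ * (√(v ⬝ᵥ v))⁻¹ = (v ⬝ᵥ v)⁻¹ := by
    rw [← mul_inv, Real.mul_self_sqrt hpos.le]
  have := h ((√(v ⬝ᵥ v))⁻¹ • v) (by
    rw [smul_dotProduct, dotProduct_smul, smul_smul, hs, smul_eq_mul, inv_mul_cancel₀ hpos.ne'])
  rw [Matrix.mulVec_smul, smul_dotProduct, dotProduct_smul, smul_smul, hs, smul_eq_mul,
    inv_mul_eq_div, le_div_iff₀ hpos] at this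
  exact this

theorem IsQuadraticModule.isCompact_nonneg {σ : Type*} {Q : Set (MvPolynomial σ ℝ)}
    (hb : IsBounding Q) : IsCompact {x : σ → ℝ | ∀ q ∈ Q, 0 ≤ MvPolynomial.eval x q} := by
  choose r hr using fun i : σ => hb (MvPolynomial.X i)
  choose s hs using fun i : σ => hb (-MvPolynomial.X i)
  refine (isCompact_univ_pi fun i : σ => isCompact_Icc (a := -s i) (b := r i)).of_isClosed_subset
    ?_ fun x hx i _ => ?_
  · simp only [Set.ofPred_forall]
    exact isClosed_biInter fun q _ => isClosed_le continuous_const (MvPolynomial.continuous_eval q)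
  · have h₁ := hx _ (hr i)
    have h₂ := hx _ (hs i)
    simp only [MvPolynomial.algebraMap_eq, map_sub, map_neg, MvPolynomial.eval_C,
      MvPolynomial.eval_X] at h₁ h₂
    constructor <;> linarith

/-! ### The matrix quadratic module and its scalar part. -/

section MatPoly

variable {n t : ℕ} {G : Set (MatPoly n t)}

theorem add_mem_quadraticModule {a b : MatPoly n t} (ha : a ∈ quadraticModule G)
    (hb : b ∈ quadraticModule G) : a + b ∈ quadraticModule G := by
  obtain ⟨N, g, p, hg, rfl⟩ := ha
  obtain ⟨N', g', p', hg', rfl⟩ := hb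
  refine ⟨N + N', Fin.append g g', Fin.append p p', fun i => ?_, ?_⟩
  · refine Fin.addCases (fun i => ?_) (fun i => ?_) i
    · simpa using hg i
    · simpa using hg' i
  · simp [Fin.sum_univ_add]

theorem conj_mem_quadraticModule {a : MatPoly n t} (ha : a ∈ quadraticModule G)
    (b : MatPoly n t) : b.transpose * a * b ∈ quadraticModule G := by
  obtain ⟨N, g, p, hg, rfl⟩ := ha
  refine ⟨N, g, fun i => p i * b, hg, ?_⟩
  simp only [Matrix.mul_sum, Matrix.sum_mul, Matrix.transpose_mul, Matrix.mul_assoc]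

theorem mem_quadraticModule_of_mem {g : MatPoly n t} (hg : g ∈ ({1} ∪ G : Set (MatPoly n t))) :
    g ∈ quadraticModule G :=
  ⟨1, fun _ => g, fun _ => 1, fun _ => hg, by simp⟩

theorem one_mem_quadraticModule : 1 ∈ quadraticModule G :=
  mem_quadraticModule_of_mem (Or.inl rfl)

theorem sum_mem_quadraticModule {κ : Type*} (s : Finset κ) {a : κ → MatPoly n t}
    (ha : ∀ i ∈ s, a i ∈ quadraticModule G) : ∑ i ∈ s, a i ∈ quadraticModule G :=
  Finset.sum_induction a (· ∈ quadraticModule G) (fun _ _ => add_mem_quadraticModule)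
    ⟨0, Fin.elim0, Fin.elim0, fun i => i.elim0, by simp⟩ ha

variable (G) in
/-- The polynomials whose scalar multiple of the identity matrix lies in `quadraticModule G`. -/
def scalarPart : Set (MvPolynomial (Fin n) ℝ) :=
  {m | m • (1 : MatPoly n t) ∈ quadraticModule G}

theorem smul_transpose_mul_self_mem {m : MvPolynomial (Fin n) ℝ} (hm : m ∈ scalarPart G)
    (b : MatPoly n t) : m • (b.transpose * b) ∈ quadraticModule G := by
  simpa using conj_mem_quadraticModule hm b

theorem isQuadraticModule_scalarPart : IsQuadraticModule (scalarPart G) where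
  one_mem := by simpa [scalarPart] using one_mem_quadraticModule
  add_mem ha hb := by
    simpa only [scalarPart, Set.mem_ofPred_eq, add_smul] using add_mem_quadraticModule ha hb
  sq_mul_mem a b hb := by
    simpa [scalarPart, smul_smul, sq, mul_comm, mul_left_comm] using
      smul_transpose_mul_self_mem hb (a • (1 : MatPoly n t))

theorem isBounding_scalarPart (h : IsArchimedean (quadraticModule G)) :
    IsBounding (scalarPart G) := by
  intro a
  obtain ⟨N, -, hN⟩ := h (a • 1)
  have hN' : (N : MvPolynomial (Fin n) ℝ) - a ^ 2 ∈ scalarPart G := by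
    rw [scalarPart, Set.mem_ofPred_eq, sub_smul, Nat.cast_smul_eq_nsmul, nsmul_one]
    simpa [smul_smul, sq] using hN
  -- `N + 1/4 - a = (N - a²) + (a - 1/2)²`.
  refine ⟨N + 1 / 4, ?_⟩
  have hQ := isQuadraticModule_scalarPart (G := G)
  convert hQ.add_mem hN' (hQ.sq_mem (a - algebraMap ℝ _ (1 / 2))) using 1
  have e₁ : algebraMap ℝ (MvPolynomial (Fin n) ℝ) (1 / 4) =
      algebraMap ℝ _ (1 / 2) * algebraMap ℝ _ (1 / 2) := by rw [← map_mul]; norm_num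
  have e₂ : algebraMap ℝ (MvPolynomial (Fin n) ℝ) (1 / 2) +
      algebraMap ℝ _ (1 / 2) = 1 := by rw [← map_add]; norm_num
  rw [map_add, map_natCast]
  linear_combination e₁ + a * e₂

/-- Conjugating `g` by the matrix with `j`-th column `w` and zeros elsewhere leaves `wᵀgw` at the
entry `(j, j)`; sum over `j`. Constant `w` is what places `K` inside `S_G`. -/
theorem dotProduct_mulVec_mem_scalarPart {g : MatPoly n t} (hg : g ∈ quadraticModule G)
    (w : Fin t → MvPolynomial (Fin n) ℝ) : w ⬝ᵥ g.mulVec w ∈ scalarPart G := by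
  have : (w ⬝ᵥ g.mulVec w) • (1 : MatPoly n t) = ∑ j,
      (Matrix.vecMulVec w (Pi.single j 1)).transpose * g * Matrix.vecMulVec w (Pi.single j 1) := by
    have hj : ∀ j, (Matrix.vecMulVec w (Pi.single j 1)).transpose * g *
        Matrix.vecMulVec w (Pi.single j 1) =
        (w ⬝ᵥ g.mulVec w) • (Matrix.single j j 1 : MatPoly n t) := fun j => by
      rw [Matrix.transpose_vecMulVec, Matrix.vecMulVec_mul, Matrix.vecMulVec_mul_vecMulVec,
        ← Matrix.dotProduct_mulVec, Matrix.vecMulVec_smul,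
        Matrix.single_eq_single_vecMulVec_single]
    simp only [hj]
    rw [← Finset.smul_sum, Matrix.sum_single_one]
  rw [scalarPart, Set.mem_ofPred_eq, this]
  exact sum_mem_quadraticModule _ fun j _ => conj_mem_quadraticModule hg _

theorem dotProduct_evalAt_mulVec (x : Fin n → ℝ) (g : MatPoly n t) (v : Fin t → ℝ) :
    v ⬝ᵥ (evalAt x g).mulVec v = MvPolynomial.eval x
      ((fun i => MvPolynomial.C (v i)) ⬝ᵥ g.mulVec fun i => MvPolynomial.C (v i)) := by
  simp [dotProduct, Matrix.mulVec, evalAt]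

theorem isSymm_evalAt (x : Fin n → ℝ) {g : MatPoly n t} (hg : g.IsSymm) :
    (evalAt x g).IsSymm := by
  rw [Matrix.IsSymm, evalAt, ← Matrix.transpose_map, hg.eq]

theorem mem_positivitySet (hG : ∀ g ∈ G, g.IsSymm) {x : Fin n → ℝ}
    (hx : ∀ q ∈ scalarPart G, 0 ≤ MvPolynomial.eval x q) : x ∈ positivitySet G := by
  intro g hg
  refine .of_dotProduct_mulVec_nonneg ?_ fun v => ?_
  · rw [Matrix.IsHermitian, Matrix.conjTranspose_eq_transpose_of_trivial]
    exact isSymm_evalAt x (hG g hg)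
  · rw [star_trivial, dotProduct_evalAt_mulVec]
    exact hx _ (dotProduct_mulVec_mem_scalarPart (mem_quadraticModule_of_mem (Or.inr hg)) _)

theorem evalAt_aeval (x : Fin n → ℝ) (f : MatPoly n t) (u : Polynomial ℝ) :
    evalAt x (Polynomial.aeval f u) = Polynomial.aeval (evalAt x f) u :=
  (Polynomial.aeval_algHom_apply (MvPolynomial.aeval x : _ →ₐ[ℝ] ℝ).mapMatrix f u).symm

/-- A symmetric matrix polynomial with entries dominated by the constant `c` lies in the quadratic
module after adding `t * c`. -/
theorem smul_one_add_mem {h : MatPoly n t} (hh : h.IsSymm) {c : MvPolynomial (Fin n) ℝ}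
    (h₁ : ∀ i j, c + h i j ∈ scalarPart G) (h₂ : ∀ i j, c - h i j ∈ scalarPart G) :
    ((t : MvPolynomial (Fin n) ℝ) * c) • (1 : MatPoly n t) + h ∈ quadraticModule G := by
  set E : Fin t → Fin t → MatPoly n t := fun i j => Matrix.single i j 1 with hE
  have hET : ∀ i j, (E i j).transpose = E j i := fun i j => Matrix.transpose_single _ _ _
  have hEE : ∀ i j k, E i j * E j k = E i k := fun i j k => by simp [hE]
  have hone : ∑ i, E i i = 1 := Matrix.sum_single_one
  have hsum : ∑ i, ∑ j, h i j • E i j = h := by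
    simpa [hE] using (Matrix.matrix_eq_sum_single h).symm
  have hsum' : ∑ i, ∑ j, h i j • E j i = h := by
    rw [Finset.sum_comm]
    simpa only [fun i j => hh.apply i j] using hsum
  -- Weight the squares of `Eᵢᵢ ± Eᵢⱼ` by `c ± hᵢⱼ`: the `c` cross terms and the diagonal `h` terms
  -- cancel.
  have hpair : ∀ i j, (2 : ℕ) • (c • E i i + c • E j j + h i j • E i j + h i j • E j i) ∈
      quadraticModule G := by
    intro i j
    have h₃ := smul_transpose_mul_self_mem (h₁ i j) (E i i + E i j)
    have h₄ := smul_transpose_mul_self_mem (h₂ i j) (E i i - E i j)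
    convert add_mem_quadraticModule h₃ h₄ using 1
    simp only [Matrix.transpose_add, Matrix.transpose_sub, hET, add_mul, mul_add, sub_mul, mul_sub,
      hEE]
    module
  have htotal : (4 : ℕ) • (((t : MvPolynomial (Fin n) ℝ) * c) • (1 : MatPoly n t) + h) ∈
      quadraticModule G := by
    convert sum_mem_quadraticModule Finset.univ fun i _ =>
      sum_mem_quadraticModule Finset.univ fun j _ => hpair i j using 1
    simp only [← Finset.smul_sum, Finset.sum_add_distrib, hsum, hsum', hone, Finset.sum_const,
      Finset.card_univ, Fintype.card_fin, ← Nat.cast_smul_eq_nsmul (MvPolynomial (Fin n) ℝ)]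
    module
  convert conj_mem_quadraticModule htotal ((1 / 2 : ℝ) • (1 : MatPoly n t)) using 1
  rw [Matrix.transpose_smul, Matrix.transpose_one, smul_mul_assoc, one_mul, mul_smul_comm, mul_one,
    smul_smul, ← Nat.cast_smul_eq_nsmul ℝ, smul_smul]
  norm_num

theorem isSymm_aeval {f : MatPoly n t} (hf : f.IsSymm) (u : Polynomial ℝ) :
    (Polynomial.aeval f u).IsSymm := by
  induction u using Polynomial.induction_on' with
  | add p q hp hq => rw [map_add]; exact hp.add hq
  | monomial k a =>
    rw [Polynomial.aeval_monomial, ← Algebra.smul_def]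
    exact (hf.pow k).smul a

end MatPoly

end MatrixPositivstellensatz

/-! ### The matrix Positivstellensatz. -/

open MatrixPositivstellensatz in
theorem theorem13 (n t : ℕ) (G : Set (MatrixPositivstellensatz.MatPoly n t))
    (f : MatrixPositivstellensatz.MatPoly n t)
    (hG : ∀ g ∈ G, g.IsSymm) (hf : f.IsSymm)
    (harch : MatrixPositivstellensatz.IsArchimedean (MatrixPositivstellensatz.quadraticModule G))
    (hpos : ∀ x ∈ MatrixPositivstellensatz.positivitySet G,
      (MatrixPositivstellensatz.evalAt x f).PosDef) :
    f ∈ MatrixPositivstellensatz.quadraticModule G := by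
  have hQ := isQuadraticModule_scalarPart (G := G)
  have hb := isBounding_scalarPart harch
  set K := {x : Fin n → ℝ | ∀ q ∈ scalarPart G, 0 ≤ MvPolynomial.eval x q} with hK
  have hcpt : IsCompact (K ×ˢ {v : Fin t → ℝ | v ⬝ᵥ v = 1}) :=
    (IsQuadraticModule.isCompact_nonneg hb).prod (isCompact_setOf_dotProduct_self_eq_one _)
  have hcont : Continuous fun z : (Fin n → ℝ) × (Fin t → ℝ) => z.2 ⬝ᵥ (evalAt z.1 f).mulVec z.2 := by
    simp only [dotProduct, Matrix.mulVec, evalAt, Matrix.map_apply]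
    have := fun i j => (MvPolynomial.continuous_eval (f i j)).comp
      (continuous_fst (X := Fin n → ℝ) (Y := Fin t → ℝ))
    simp only [Function.comp_def] at this
    fun_prop
  -- This form of the minimum principle also gives a positive `ε` when the compact set is empty.
  obtain ⟨ε, hε, hlow⟩ := hcpt.exists_forall_le' hcont.continuousOn (a := 0) fun z hz =>
    (hpos z.1 (mem_positivitySet hG hz.1)).dotProduct_mulVec_pos (x := z.2) <| by
      rintro h
      simpa [h] using hz.2
  obtain ⟨b, hup⟩ := hcpt.bddAbove_image hcont.continuousOn
  -- `t` copies of `c` absorb the error `u(f)`; the spare one keeps the denominator nonzero for `t =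
  -- 0`. Approximating to `c / 2` makes `c ± u(f)ᵢⱼ` strictly positive on `K`.
  set c : ℝ := ε / (t + 1) with hc
  have hcpos : 0 < c := by positivity
  obtain ⟨q, hq⟩ := exists_polynomial_sq_near_sub ε b (half_pos hcpos)
  set u : Polynomial ℝ := Polynomial.X - Polynomial.C ε - q ^ 2 with hu
  have hentry : ∀ x ∈ K, ∀ i j, |MvPolynomial.eval x (Polynomial.aeval f u i j)| ≤ c / 2 := by
    intro x hx i j
    change |evalAt x (Polynomial.aeval f u) i j| ≤ c / 2
    rw [evalAt_aeval]
    refine abs_aeval_apply_le (a := ε) (b := b) (isSymm_evalAt x hf)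
      (mul_dotProduct_le_of_unit fun v hv => hlow (x, v) ⟨hx, hv⟩) (fun v => ?_)
      (by simpa [hu] using hq) i j
    have := mul_dotProduct_le_of_unit (A := -evalAt x f) (a := -b) (fun v hv => by
      simpa [Matrix.neg_mulVec] using hup ⟨(x, v), ⟨hx, hv⟩, rfl⟩) v
    simpa [Matrix.neg_mulVec] using this
  have hmem := smul_one_add_mem (G := G) (isSymm_aeval hf u) (c := MvPolynomial.C c)
    (fun i j => hQ.mem_of_pos hb fun x hx => by
      rw [map_add, MvPolynomial.eval_C]
      linarith [neg_le_of_abs_le (hentry x hx i j)])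
    (fun i j => hQ.mem_of_pos hb fun x hx => by
      rw [map_sub, MvPolynomial.eval_C]
      linarith [le_of_abs_le (hentry x hx i j)])
  have hsq := conj_mem_quadraticModule (one_mem_quadraticModule (G := G)) (Polynomial.aeval f q)
  have hconst : (MvPolynomial.C c : MvPolynomial (Fin n) ℝ) • (1 : MatPoly n t) ∈ quadraticModule G :=
    hQ.algebraMap_mem hcpos.le
  convert add_mem_quadraticModule (add_mem_quadraticModule hmem hconst) hsq using 1
  have hεc : ((t : MvPolynomial (Fin n) ℝ) * MvPolynomial.C c) • (1 : MatPoly n t) +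
      (MvPolynomial.C c : MvPolynomial (Fin n) ℝ) • (1 : MatPoly n t) = algebraMap ℝ (MatPoly n t) ε := by
    rw [← add_smul, ← add_one_mul, ← map_natCast MvPolynomial.C, ← map_one MvPolynomial.C,
      ← map_add, ← map_mul, hc, mul_div_cancel₀ _ (by positivity), Algebra.algebraMap_eq_smul_one,
      ← MvPolynomial.algebraMap_eq, algebraMap_smul]
  rw [(isSymm_aeval hf q).eq, mul_one, add_right_comm _ (Polynomial.aeval f u), hεc, hu, map_sub, map_sub, map_pow,
    Polynomial.aeval_X, Polynomial.aeval_C, sq]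
  abel
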